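/- Let $k\in\{2,3,\dots\}\cup\{\infty\}$, let $\mathcal M$ be an oriented $M$-dimensional manifold of class $C^k$ (Hausdorff and paracompact, without boundary), let $L$ be a positive integer and let $0\le h\le M-1$. A matrix-valued $C^p$ differential $q$-form on $\mathcal M$ is an $L\times L$ matrix $\omega=(\omega^{(ij)})$ of real differential $q$-forms whose coefficients in every $C^k$ chart are of class $C^p$; its value $\omega_P$ at a point $P$, its exterior derivative $d\omega$ and its integral are taken entrywise, and $(\lambda\wedge\mu)^{(ij)}=\sum_{s}\lambda^{(is)}\wedge\mu^{(sj)}$. Let $\gamma$ be a matrix-valued $C^0$ differential $h$-form on $\mathcal M$ that has a continuous distributional exterior derivative $\delta\gamma$, i.e. $\delta\gamma$ is a matrix-valued $C^0$ differential $(h+1)$-form on $\mathcal M$ such that $$\int_{\mathcal M}\gamma\wedge d\varphi=(-1)^{h+1}\int_{\mathcal M}\delta\gamma\wedge\varphi$$ for every compactly supported matrix-valued $C^{k-1}$ differential $(M-h-1)$-form $\varphi$ on $\mathcal M$ (with $k-1=\infty$ if $k=\infty$). Let $\mathcal Z_\gamma:=\{P\in\mathcal M\mid \gamma_P=0\}$.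 Then $(\delta\gamma)_Q=0$ for every $(M+1)$-density point $Q$ of $\mathcal Z_\gamma$, that is, for every $Q\in\mathcal M$ for which there is a $C^1$ chart $(\mathcal W,\Phi)$ of $\mathcal M$ with $Q\in\mathcal W$ and $$\mathcal L^M\bigl(B_r(\Phi(Q))\setminus\Phi(\mathcal Z_\gamma\cap\mathcal W)\bigr)=o(r^{M+1})\qquad(r\to0+),$$ where $\mathcal L^M$ is Lebesgue measure on $\mathbb R^M$ and $B_r(x)$ is the open Euclidean ball of radius $r$ centred at $x$. -/

import Mathlib

open Set Filter Topology MeasureTheory Asymptotics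
open scoped Manifold

noncomputable section

namespace SuperdensityForms

/-- The model space `ℝ^M`, with the Euclidean norm. -/
abbrev E (M : ℕ) : Type := EuclideanSpace ℝ (Fin M)

/-! ### Exterior product of alternating forms on a vector space -/

section Wedge

variable {V : Type*} [AddCommGroup V] [Module ℝ V]

/-- The exterior product `a ∧ b` as an algebraic alternating form. It is the sum over
`(p, q)`-shuffles, i.e. `AlternatingMap.domCoprod` followed by multiplication `ℝ ⊗ ℝ → ℝ`, with the
arguments numbered by `Fin n`, those of `a` first. -/
def wedgeAlg {p q n : ℕ} (hn : p + q = n) (a : V [⋀^Fin p]→ₗ[ℝ] ℝ) (b : V [⋀^Fin q]→ₗ[ℝ] ℝ) :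
    V [⋀^Fin n]→ₗ[ℝ] ℝ :=
  ((LinearMap.mul' ℝ ℝ).compAlternatingMap (a.domCoprod b)).domDomCongr
    (finSumFinEquiv.trans (finCongr hn))

variable [TopologicalSpace V]

theorem continuous_wedgeAlg {p q n : ℕ} (hn : p + q = n)
    (a : V [⋀^Fin p]→L[ℝ] ℝ) (b : V [⋀^Fin q]→L[ℝ] ℝ) :
    Continuous (fun v : Fin n → V => wedgeAlg hn a.toAlternatingMap b.toAlternatingMap v) := by
  unfold wedgeAlg
  simp only [AlternatingMap.domDomCongr_apply, LinearMap.compAlternatingMap_apply,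
    AlternatingMap.domCoprod_apply, _root_.sum_apply, map_sum]
  refine continuous_finsetSum _ fun σ _ => ?_
  induction σ using Quotient.inductionOn' with
  | h σ =>
    simp only [AlternatingMap.domCoprod.summand_mk'', _root_.smul_apply,
      MultilinearMap.domDomCongr_apply, MultilinearMap.domCoprod_apply, map_zsmul_unit,
      LinearMap.mul'_apply]
    refine Continuous.const_smul (Continuous.mul ?_ ?_) _
    · exact a.coe_continuous.comp (continuous_pi fun i => continuous_apply _)
    · exact b.coe_continuous.comp (continuous_pi fun i => continuous_apply _)

/-- The exterior product `a ∧ b` of continuous alternating forms. -/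
def wedge {p q n : ℕ} (hn : p + q = n) (a : V [⋀^Fin p]→L[ℝ] ℝ) (b : V [⋀^Fin q]→L[ℝ] ℝ) :
    V [⋀^Fin n]→L[ℝ] ℝ :=
  { wedgeAlg hn a.toAlternatingMap b.toAlternatingMap with
    cont := continuous_wedgeAlg hn a b }

end Wedge

/-! ### Differential forms on a manifold -/

section Forms

variable (M : ℕ) (X : Type*) [TopologicalSpace X] [ChartedSpace (E M) X]

/-- A (not necessarily regular) differential `h`-form on the `M`-dimensional manifold `X`. -/
abbrev DForm (h : ℕ) : Type _ := ∀ x : X, (TangentSpace (𝓡 M) x) [⋀^Fin h]→L[ℝ] ℝ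

/-- An `L × L` matrix of differential `h`-forms. -/
abbrev MatForm (L h : ℕ) : Type _ := Matrix (Fin L) (Fin L) (DForm M X h)

variable {M X}

/-- The local representation `(e⁻¹)^* ω` of `ω` in the chart `e`; only its values on `e.target`
are meaningful. -/
def localRep {h : ℕ} (e : OpenPartialHomeomorph X (E M)) (ω : DForm M X h) :
    E M → (E M) [⋀^Fin h]→L[ℝ] ℝ :=
  fun y => (ω (e.symm y)).compContinuousLinearMap (mfderiv (𝓡 M) (𝓡 M) e.symm y)

/-- `ω` is a form of class `C^p` on the `C^k` manifold `X`: its local representation in every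
`C^k` chart is of class `C^p`. -/
def IsFormOfClass {h : ℕ} (k p : WithTop ℕ∞) (ω : DForm M X h) : Prop :=
  ∀ e ∈ IsManifold.maximalAtlas (𝓡 M) k X, ContDiffOn ℝ p (localRep e ω) e.target

/-- The support of a differential form. -/
def formSupport {h : ℕ} (ω : DForm M X h) : Set X := closure {x | ω x ≠ 0}

/-- The exterior derivative, computed at each point in the preferred chart at that point. -/
def dForm {h : ℕ} (ω : DForm M X h) : DForm M X (h + 1) :=
  fun x => (extDeriv (localRep (chartAt (E M) x) ω) (chartAt (E M) x x)).compContinuousLinearMap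
    (mfderiv (𝓡 M) (𝓡 M) (chartAt (E M) x) x)

/-- Exterior product of differential forms. -/
def wedgeForm {p q n : ℕ} (hn : p + q = n) (ω : DForm M X p) (η : DForm M X q) : DForm M X n :=
  fun x => wedge hn (ω x) (η x)

namespace MatForm

variable {L : ℕ}

/-- The value of a matrix-valued form at a point, a matrix of alternating forms on the tangent
space. -/
def eval {h : ℕ} (ω : MatForm M X L h) (x : X) :
    Matrix (Fin L) (Fin L) ((TangentSpace (𝓡 M) x) [⋀^Fin h]→L[ℝ] ℝ) :=
  Matrix.of fun i j => ω i j x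

/-- All the entries are of class `C^p`. -/
def IsOfClass {h : ℕ} (k p : WithTop ℕ∞) (ω : MatForm M X L h) : Prop :=
  ∀ i j, IsFormOfClass k p (ω i j)

/-- All the entries have compact support. -/
def HasCompactSupp {h : ℕ} (ω : MatForm M X L h) : Prop :=
  ∀ i j, IsCompact (formSupport (ω i j))

/-- Entrywise exterior derivative. -/
def d {h : ℕ} (ω : MatForm M X L h) : MatForm M X L (h + 1) :=
  Matrix.of fun i j => dForm (ω i j)

/-- Exterior product: `(ω ∧ η)^(ij) = ∑_s ω^(is) ∧ η^(sj)`. -/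
def wedge {p q n : ℕ} (hn : p + q = n) (ω : MatForm M X L p) (η : MatForm M X L q) :
    MatForm M X L n :=
  Matrix.of fun i j => ∑ s, wedgeForm hn (ω i s) (η s j)

/-- The vanishing set of a matrix-valued form. -/
def zeroSet {h : ℕ} (ω : MatForm M X L h) : Set X := {x | ω.eval x = 0}

end MatForm

end Forms

/-! ### Orientation and integration -/

section Integration

/-- An orientation of the `C^k` manifold `X`, given by an oriented atlas: a family of `C^k` charts
covering `X` whose transition maps have positive Jacobian determinant. -/
structure ManifoldOrientation (M : ℕ) (k : WithTop ℕ∞) (X : Type*) [TopologicalSpace X]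
    [ChartedSpace (E M) X] where
  charts : Set (OpenPartialHomeomorph X (E M))
  charts_subset : charts ⊆ IsManifold.maximalAtlas (𝓡 M) k X
  cover : ∀ x : X, ∃ e ∈ charts, x ∈ e.source
  det_pos : ∀ e ∈ charts, ∀ e' ∈ charts, ∀ y ∈ (e.symm.trans e').source,
    0 < (fderiv ℝ (e.symm.trans e') y).det

variable {M : ℕ} {k : WithTop ℕ∞} {X : Type*} [TopologicalSpace X] [ChartedSpace (E M) X]
  [T2Space X] [ParacompactSpace X]

theorem ManifoldOrientation.exists_partitionOfUnity (o : ManifoldOrientation M k X) :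
    ∃ ρ : PartitionOfUnity o.charts X univ, ρ.IsSubordinate fun e => e.1.source :=
  PartitionOfUnity.exists_isSubordinate isClosed_univ _ (fun e => e.1.open_source)
    fun x _ => by
      obtain ⟨e, he, hx⟩ := o.cover x
      exact mem_iUnion.2 ⟨⟨e, he⟩, hx⟩

/-- A partition of unity subordinate to the domains of the oriented charts. -/
def ManifoldOrientation.partition (o : ManifoldOrientation M k X) :
    PartitionOfUnity o.charts X univ :=
  o.exists_partitionOfUnity.choose

/-- The integral over the oriented manifold `X` of a continuous `M`-form with compact support:
`∑_e ∫_{e.target} (e⁻¹)^*(ρ_e ω)`, where `e` runs over the oriented charts, `ρ` is a subordinate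
partition of unity, and `∫ f dx_1 ∧ … ∧ dx_M = ∫ f dx` on `ℝ^M`. As usual, the value does not depend
on the partition of unity. -/
def ManifoldOrientation.integral (o : ManifoldOrientation M k X) (ω : DForm M X M) : ℝ :=
  ∑ᶠ e : o.charts, ∫ y in e.1.target,
    o.partition e (e.1.symm y) * localRep e.1 ω y (fun i => EuclideanSpace.single i (1 : ℝ))

/-- Entrywise integral of a matrix-valued form. -/
def ManifoldOrientation.matIntegral {L : ℕ} (o : ManifoldOrientation M k X)
    (ω : MatForm M X L M) : Matrix (Fin L) (Fin L) ℝ :=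
  Matrix.of fun i j => o.integral (ω i j)

/-- `δγ` is the distributional exterior derivative of the `h`-form `γ` on the oriented `C^k`
manifold `X` of dimension `M ≥ h + 1`: it is continuous, and
`∫ γ ∧ dφ = (-1)^(h+1) ∫ δγ ∧ φ` for all test forms `φ` of degree `p = M - h - 1`.
The test forms are those of class `C^(k-1)` with compact support: `k - 1` is the largest order of
regularity of a form that is preserved by the coordinate changes of a `C^k` manifold
(`k - 1 = ∞` if `k = ∞`). -/
def IsDED {k : ℕ∞} {L h : ℕ} (o : ManifoldOrientation M k X)
    (γ : MatForm M X L h) (δγ : MatForm M X L (h + 1)) : Prop :=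
  δγ.IsOfClass k 0 ∧
  ∀ (p : ℕ) (hp : h + 1 + p = M) (φ : MatForm M X L p),
    φ.IsOfClass k ((k - 1 : ℕ∞) : WithTop ℕ∞) → φ.HasCompactSupp →
    o.matIntegral (MatForm.wedge (show h + (p + 1) = M by omega) γ φ.d) =
      (-1 : ℝ) ^ (h + 1) • o.matIntegral (MatForm.wedge hp δγ φ)

end Integration

/-! ### Superdensity -/

/-- `P` is an `m`-density point of `A ⊆ X`: in some `C^1` chart `e` around `P`,
`ℒ^M(B_r(e P) \ e(A ∩ W)) = o(r^m)` as `r → 0+`, where `W` is the domain of `e`. -/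
def IsDensityPoint {M : ℕ} {X : Type*} [TopologicalSpace X] [ChartedSpace (E M) X]
    (m : ℝ) (A : Set X) (P : X) : Prop :=
  ∃ e ∈ IsManifold.maximalAtlas (𝓡 M) 1 X, P ∈ e.source ∧
    (fun r : ℝ => (volume (Metric.ball (e P) r \ e '' (A ∩ e.source))).toReal)
      =o[𝓝[>] 0] fun r : ℝ => r ^ m

end SuperdensityForms

end

/-! The statement is local and comes from one scaling estimate. In an oriented chart around `Q`,
with `y₀` the image of `Q`, the defining identity is tested with `f_r • c`, where `c` is a constant
form of degree `p = M - h - 1` and `f_r` is a fixed bump rescaled to `B_r(y₀)`. Its exterior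
derivative is `O(1/r)` and vanishes off the ball, while `γ` vanishes on its zero set. Hence `∫ γ ∧
d(f_r c)` is at most `C / r` times the volume of the part of the ball outside the zero set, which is
`o(r^M)` by superdensity. The other side is, up to sign, `∫ f_r (δγ ∧ c)`; if `δγ ∧ c` were nonzero
at `y₀`, continuity would make this at least a positive constant times `r^M` in absolute value. So
`δγ ∧ c` vanishes at `y₀` (`wedge_eq_zero_of_density`) for every `c`, and nondegeneracy of the wedge
pairing (`eq_zero_of_wedge_eq_zero`) kills `δγ` at `Q`.

Two transfers make this legitimate on a manifold. The density condition passes from the given `C^1`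
chart to the oriented one (`isLittleO_density_chart`). The global identity becomes an identity of
integrals in one chart (`IsDED.setIntegral_eq`): test forms are extended by zero, `2 ≤ k` makes `d`
independent of the chart, orientation makes the integral so, and a diagonal matrix unit isolates
each entry of `γ`. -/

noncomputable section

namespace SuperdensityForms

/-! ### Algebra of the exterior product; nondegeneracy in complementary degrees. -/

section WedgeAlgebra

variable {V W : Type*} [AddCommGroup V] [Module ℝ V] [TopologicalSpace V]
  [AddCommGroup W] [Module ℝ W] [TopologicalSpace W]

/-- The exterior product as a sum over chosen representatives of the shuffles. -/
theorem wedge_apply {p q n : ℕ} (hn : p + q = n)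
    (a : V [⋀^Fin p]→L[ℝ] ℝ) (b : V [⋀^Fin q]→L[ℝ] ℝ) (v : Fin n → V) :
    wedge hn a b v = ∑ σ : Equiv.Perm.ModSumCongr (Fin p) (Fin q),
      ((Equiv.Perm.sign (Quotient.out σ) : ℤ) : ℝ) *
        (a (fun i => v (Fin.cast hn (finSumFinEquiv (Quotient.out σ (Sum.inl i))))) *
          b (fun j => v (Fin.cast hn (finSumFinEquiv (Quotient.out σ (Sum.inr j)))))) := by
  change wedgeAlg hn a.toAlternatingMap b.toAlternatingMap v = _
  unfold wedgeAlg
  simp only [AlternatingMap.domDomCongr_apply, LinearMap.compAlternatingMap_apply,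
    AlternatingMap.domCoprod_apply, _root_.sum_apply, map_sum]
  refine Finset.sum_congr rfl fun σ _ => ?_
  conv_lhs => rw [← Quotient.out_eq' σ]
  simp only [AlternatingMap.domCoprod.summand_mk'', _root_.smul_apply,
      MultilinearMap.domDomCongr_apply, MultilinearMap.domCoprod_apply, map_zsmul_unit,
      LinearMap.mul'_apply]
  rw [Units.smul_def, zsmul_eq_mul]
  rfl

theorem wedge_compContinuousLinearMap {p q n : ℕ} (hn : p + q = n)
    (a : V [⋀^Fin p]→L[ℝ] ℝ) (b : V [⋀^Fin q]→L[ℝ] ℝ) (f : W →L[ℝ] V) :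
    (wedge hn a b).compContinuousLinearMap f =
      wedge hn (a.compContinuousLinearMap f) (b.compContinuousLinearMap f) := by
  ext v
  simp only [ContinuousAlternatingMap.compContinuousLinearMap_apply, wedge_apply]
  rfl

theorem wedge_zero_left {p q n : ℕ} (hn : p + q = n) (b : V [⋀^Fin q]→L[ℝ] ℝ) :
    wedge hn (0 : V [⋀^Fin p]→L[ℝ] ℝ) b = 0 := by
  ext v
  simp [wedge_apply]

theorem wedge_zero_right {p q n : ℕ} (hn : p + q = n) (a : V [⋀^Fin p]→L[ℝ] ℝ) :
    wedge hn a (0 : V [⋀^Fin q]→L[ℝ] ℝ) = 0 := by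
  ext v
  simp [wedge_apply]

theorem wedge_smul_right_apply {p q n : ℕ} (hn : p + q = n) (a : V [⋀^Fin p]→L[ℝ] ℝ) (r : ℝ)
    (b : V [⋀^Fin q]→L[ℝ] ℝ) (v : Fin n → V) :
    wedge hn a (r • b) v = r * wedge hn a b v := by
  simp only [wedge_apply, Finset.mul_sum, ContinuousAlternatingMap.smul_apply, smul_eq_mul]
  exact Finset.sum_congr rfl fun σ _ => by ring

/-- If `b` vanishes on every choice of arguments that contains one of the first `p` vectors, only
the identity shuffle contributes to the exterior product. -/
theorem wedge_apply_of_vanishing {p q n : ℕ} (hn : p + q = n)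
    (a : V [⋀^Fin p]→L[ℝ] ℝ) (b : V [⋀^Fin q]→L[ℝ] ℝ) (v : Fin p ⊕ Fin q → V)
    (hb : ∀ w : Fin q → Fin p ⊕ Fin q, (∃ i j, w i = Sum.inl j) → b (fun i => v (w i)) = 0) :
    wedge hn a b (fun i => v (finSumFinEquiv.symm (Fin.cast hn.symm i))) =
      a (fun i => v (Sum.inl i)) * b (fun j => v (Sum.inr j)) := by
  change wedgeAlg hn a.toAlternatingMap b.toAlternatingMap _ = _
  unfold wedgeAlg
  simp only [AlternatingMap.domDomCongr_apply, LinearMap.compAlternatingMap_apply,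
    AlternatingMap.domCoprod_apply, _root_.sum_apply, map_sum]
  refine (Fintype.sum_eq_single
    (Quotient.mk'' (1 : Equiv.Perm (Fin p ⊕ Fin q)) : Equiv.Perm.ModSumCongr (Fin p) (Fin q))
    fun σ hσ => ?_).trans ?_
  · induction σ using Quotient.inductionOn' with
    | h σ =>
      have h0 : b (fun i => v (σ (Sum.inr i))) = 0 := by
        apply hb (fun j => σ (Sum.inr j))
        -- If `σ` sent no right index to the left block, it would preserve both blocks and so lie in
        -- the class of the identity.
        by_contra hcon
        push Not at hcon
        apply hσ
        apply Quotient.sound'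
        rw [QuotientGroup.leftRel_apply, mul_one]
        apply Subgroup.inv_mem
        apply Equiv.Perm.mem_sumCongrHom_range_of_perm_mapsTo_inl
        rw [Equiv.Perm.perm_mapsTo_inl_iff_mapsTo_inr]
        rintro _ ⟨j, rfl⟩
        rcases hc : σ (Sum.inr j) with i | i
        · exact absurd hc (hcon j i)
        · exact ⟨i, rfl⟩
      simp only [AlternatingMap.domCoprod.summand_mk'', _root_.smul_apply,
        MultilinearMap.domDomCongr_apply, MultilinearMap.domCoprod_apply, map_zsmul_unit,
        LinearMap.mul'_apply]
      simp [h0]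
  · simp [AlternatingMap.domCoprod.summand_mk'']

/-- The coordinate minor form `dx_{w 0} ∧ … ∧ dx_{w (q - 1)}` on `ℝ^M`. -/
def minorForm {M q : ℕ} (w : Fin q → Fin M) : (E M) [⋀^Fin q]→L[ℝ] ℝ :=
  { (Matrix.detRowAlternating (n := Fin q) (R := ℝ)).compLinearMap
      (LinearMap.pi fun j => (EuclideanSpace.proj (𝕜 := ℝ) (w j)).toLinearMap) with
    cont := by
      change Continuous fun v : Fin q → E M => Matrix.det (Matrix.of fun i j => v i (w j))
      fun_prop }

theorem minorForm_apply {M q : ℕ} (w : Fin q → Fin M) (v : Fin q → E M) :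
    minorForm w v = Matrix.det (Matrix.of fun i j => v i (w j)) :=
  rfl

/-- The exterior product pairing of complementary degrees is nondegenerate. -/
theorem eq_zero_of_wedge_eq_zero {M p q : ℕ} (hn : p + q = M) (a : (E M) [⋀^Fin p]→L[ℝ] ℝ)
    (ha : ∀ b : (E M) [⋀^Fin q]→L[ℝ] ℝ,
      wedge hn a b (fun i => EuclideanSpace.single i (1 : ℝ)) = 0) : a = 0 := by
  have key : a.toAlternatingMap = 0 := by
    refine Module.Basis.ext_alternating (EuclideanSpace.basisFun (Fin M) ℝ).toBasis fun u hu => ?_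
    have hcard : Fintype.card ((Set.range u)ᶜ : Set (Fin M)) = q := by
      rw [Fintype.card_compl_set, Set.card_range_of_injective hu]
      simp
      omega
    -- `w` enumerates the indices missed by `u`; the test form is the minor `dx_w`, which vanishes
    -- as soon as one argument is a basis vector indexed by `u`.
    let c : Fin q ≃ ((Set.range u)ᶜ : Set (Fin M)) := (Fintype.equivFinOfCardEq hcard).symm
    let w : Fin q → Fin M := fun j => (c j : Fin M)
    have huw : ∀ i j, u i ≠ w j := fun i j h => (c j).2 ⟨i, h⟩
    have hw : Function.Injective w := Subtype.val_injective.comp c.injective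
    let f : Fin p ⊕ Fin q → Fin M := Sum.elim u w
    have hf : Function.Injective f := hu.sumElim hw huw
    let v : Fin p ⊕ Fin q → E M := fun s => EuclideanSpace.single (f s) (1 : ℝ)
    have h1 := wedge_apply_of_vanishing hn a (minorForm w) v (by
      rintro t ⟨i, j, hij⟩
      rw [minorForm_apply]
      refine Matrix.det_eq_zero_of_row_eq_zero i fun l => ?_
      simp [v, hij, f, (huw j l).symm])
    have h2 : minorForm w (fun j => v (Sum.inr j)) = 1 := by
      rw [minorForm_apply]
      convert Matrix.det_one (n := Fin q) (R := ℝ)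
      ext i j
      simp [v, f, Matrix.one_apply, hw.eq_iff, eq_comm]
    rw [h2, mul_one] at h1
    -- The concatenation of `u` and `w` permutes the standard frame, so the top form takes there its
    -- value on the frame up to sign, which is zero.
    have hbij : Function.Bijective
        (fun i : Fin M => f (finSumFinEquiv.symm (Fin.cast hn.symm i))) :=
      Finite.injective_iff_bijective.1
        (hf.comp (finSumFinEquiv.symm.injective.comp (Fin.cast_injective _)))
    have h3 : wedge hn a (minorForm w)
        (fun i => v (finSumFinEquiv.symm (Fin.cast hn.symm i))) = 0 := by
      have := (wedge hn a (minorForm w)).toAlternatingMap.map_perm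
        (fun i => EuclideanSpace.single i (1 : ℝ)) (Equiv.ofBijective _ hbij)
      refine Eq.trans this ?_
      refine Eq.trans (congrArg _ (ha (minorForm w))) (smul_zero _)
    rw [h3] at h1
    simpa [v, f] using h1.symm
  ext v
  exact congrArg (fun g => g v) key

theorem continuousOn_wedge_apply {Y V : Type*} [TopologicalSpace Y] [NormedAddCommGroup V]
    [NormedSpace ℝ V] {p q n : ℕ} (hn : p + q = n) {S : Set Y} {a : Y → V [⋀^Fin p]→L[ℝ] ℝ}
    {b : Y → V [⋀^Fin q]→L[ℝ] ℝ} (ha : ContinuousOn a S) (hb : ContinuousOn b S) (v : Fin n → V) :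
    ContinuousOn (fun y => wedge hn (a y) (b y) v) S := by
  simp only [wedge_apply]
  refine continuousOn_finsetSum _ fun σ _ => continuousOn_const.mul (ContinuousOn.mul ?_ ?_)
  · exact (continuous_eval_const _).comp_continuousOn ha
  · exact (continuous_eval_const _).comp_continuousOn hb

end WedgeAlgebra

/-! ### Smooth dependence of the pullback on the linear map. -/

section Pullback

variable {V W : Type*} [NormedAddCommGroup V] [NormedSpace ℝ V]
  [NormedAddCommGroup W] [NormedSpace ℝ W]

theorem finiteDimensional_continuousMultilinearMap [FiniteDimensional ℝ V] (n : ℕ) :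
    FiniteDimensional ℝ (ContinuousMultilinearMap ℝ (fun _ : Fin n => V) ℝ) :=
  Module.Finite.of_injective (ContinuousMultilinearMap.toMultilinearMapLinear :
      ContinuousMultilinearMap ℝ (fun _ : Fin n => V) ℝ →ₗ[ℝ] _)
    ContinuousMultilinearMap.toMultilinearMap_injective

/-- The pullback of alternating forms depends smoothly on the linear map. -/
theorem contDiff_compContinuousLinearMap [FiniteDimensional ℝ W] {n : ℕ} (c : V [⋀^Fin n]→L[ℝ] ℝ) {r : WithTop ℕ∞} :
    ContDiff ℝ r fun A : W →L[ℝ] V => c.compContinuousLinearMap A := by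
  have := finiteDimensional_continuousMultilinearMap (V := W) n
  -- Smoothness is clear for multilinear maps. In finite dimension the inclusion of alternating maps
  -- has a continuous linear left inverse, which carries it back.
  let ι := (ContinuousAlternatingMap.toContinuousMultilinearMapLI
    (𝕜 := ℝ) (E := W) (F := ℝ) (ι := Fin n))
  obtain ⟨g, hg⟩ := ι.toLinearMap.exists_leftInverse_of_injective
    (LinearMap.ker_eq_bot.2 ι.injective)
  have h1 : (fun A : W →L[ℝ] V => c.compContinuousLinearMap A) = fun A =>
      LinearMap.toContinuousLinearMap g
        (c.toContinuousMultilinearMap.compContinuousLinearMap fun _ => A) := by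
    funext A
    exact (LinearMap.congr_fun hg (c.compContinuousLinearMap A)).symm
  rw [h1]
  refine (ContinuousLinearMap.contDiff _).comp ?_
  have h2 : ContDiff ℝ r (ContinuousMultilinearMap.compContinuousLinearMapContinuousMultilinear ℝ
    (fun _ : Fin n => W) (fun _ : Fin n => V) ℝ) := ContinuousMultilinearMap.contDiff _
  exact (h2.clm_apply contDiff_const).comp (contDiff_pi.2 fun _ => contDiff_id)

end Pullback

/-! ### Change of charts for forms and their exterior derivatives. -/

section Charts

variable {M : ℕ} {X : Type*} [TopologicalSpace X] [ChartedSpace (E M) X]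
  {e e' : OpenPartialHomeomorph X (E M)}

theorem contDiffOn_transition {k : WithTop ℕ∞} [IsManifold (𝓡 M) k X]
    (he : e ∈ IsManifold.maximalAtlas (𝓡 M) k X) (he' : e' ∈ IsManifold.maximalAtlas (𝓡 M) k X) :
    ContDiffOn ℝ k (e.symm.trans e') (e.symm.trans e').source := by
  rw [← contMDiffOn_iff_contDiffOn]
  refine (contMDiffOn_of_mem_maximalAtlas he').comp
    ((contMDiffOn_symm_of_mem_maximalAtlas he).mono ?_) ?_
  · exact fun y hy => hy.1
  · exact fun y hy => hy.2

/-- The two values live in different fibres; the equation makes sense because every tangent space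
unfolds to `E M`. -/
theorem DForm.congr_point {h : ℕ} (ω : DForm M X h) {x x' : X} (hx : x = x') :
    (ω x : (E M) [⋀^Fin h]→L[ℝ] ℝ) = ω x' := by
  subst hx
  rfl

theorem mfderiv_symm_transition [IsManifold (𝓡 M) 1 X]
    (he : e ∈ IsManifold.maximalAtlas (𝓡 M) 1 X) (he' : e' ∈ IsManifold.maximalAtlas (𝓡 M) 1 X)
    {y : E M} (hy : y ∈ (e.symm.trans e').source) :
    (mfderiv (𝓡 M) (𝓡 M) e.symm y : E M →L[ℝ] E M) =
      (mfderiv (𝓡 M) (𝓡 M) e'.symm (e.symm.trans e' y) : E M →L[ℝ] E M).comp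
        (fderiv ℝ (e.symm.trans e') y) := by
  have hT : ContDiffAt ℝ 1 (e.symm.trans e') y :=
    (contDiffOn_transition he he').contDiffAt ((e.symm.trans e').open_source.mem_nhds hy)
  have h1 : e.symm =ᶠ[𝓝 y] e'.symm ∘ (e.symm.trans e') := by
    filter_upwards [(e.symm.trans e').open_source.mem_nhds hy] with z hz
    exact (e'.left_inv hz.2).symm
  have hm : e.symm.trans e' y ∈ e'.target := e'.map_source hy.2
  rw [h1.mfderiv_eq, mfderiv_comp y
    ((contMDiffAt_symm_of_mem_maximalAtlas he' hm).mdifferentiableAt one_ne_zero)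
    (hT.differentiableAt one_ne_zero).mdifferentiableAt, mfderiv_eq_fderiv]
  rfl

/-- Near `y`, `e.symm` is `e'.symm` composed with the transition map; the chain rule gives the
factor. -/
theorem localRep_transition [IsManifold (𝓡 M) 1 X] {h : ℕ} (ω : DForm M X h)
    (he : e ∈ IsManifold.maximalAtlas (𝓡 M) 1 X) (he' : e' ∈ IsManifold.maximalAtlas (𝓡 M) 1 X)
    {y : E M} (hy : y ∈ (e.symm.trans e').source) :
    localRep e ω y = (localRep e' ω (e.symm.trans e' y)).compContinuousLinearMap
      (fderiv ℝ (e.symm.trans e') y) := by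
  have h1 : (ω : X → (E M) [⋀^Fin h]→L[ℝ] ℝ) (e'.symm (e.symm.trans e' y)) = ω (e.symm y) :=
    ω.congr_point (e'.left_inv hy.2)
  have h2 := mfderiv_symm_transition he he' hy
  change ContinuousAlternatingMap.compContinuousLinearMap
      ((ω : X → (E M) [⋀^Fin h]→L[ℝ] ℝ) (e.symm y))
      (mfderiv (𝓡 M) (𝓡 M) e.symm y : E M →L[ℝ] E M) =
    ContinuousAlternatingMap.compContinuousLinearMap
      (ContinuousAlternatingMap.compContinuousLinearMap
      ((ω : X → (E M) [⋀^Fin h]→L[ℝ] ℝ) (e'.symm (e.symm.trans e' y)))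
      (mfderiv (𝓡 M) (𝓡 M) e'.symm (e.symm.trans e' y) : E M →L[ℝ] E M)) _
  rw [h1, h2]
  rfl

theorem mfderiv_comp_mfderiv_symm
    (he : e ∈ IsManifold.maximalAtlas (𝓡 M) 1 X) {y : E M} (hy : y ∈ e.target) :
    (mfderiv (𝓡 M) (𝓡 M) e (e.symm y) : E M →L[ℝ] E M).comp
      (mfderiv (𝓡 M) (𝓡 M) e.symm y : E M →L[ℝ] E M) = ContinuousLinearMap.id ℝ (E M) := by
  have h1 : e ∘ e.symm =ᶠ[𝓝 y] id := by
    filter_upwards [e.open_target.mem_nhds hy] with z hz using e.right_inv hz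
  have h2 := h1.mfderiv_eq (I := 𝓡 M) (I' := 𝓡 M)
  rw [mfderiv_id, mfderiv_comp y
    ((contMDiffAt_of_mem_maximalAtlas he (e.map_target hy)).mdifferentiableAt one_ne_zero)
    ((contMDiffAt_symm_of_mem_maximalAtlas he hy).mdifferentiableAt one_ne_zero)] at h2
  exact h2

theorem mfderiv_chart_comp_mfderiv_symm
    (he : e ∈ IsManifold.maximalAtlas (𝓡 M) 1 X) (he' : e' ∈ IsManifold.maximalAtlas (𝓡 M) 1 X)
    {y : E M} (hy : y ∈ (e.symm.trans e').source) :
    (mfderiv (𝓡 M) (𝓡 M) e' (e.symm y) : E M →L[ℝ] E M).comp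
      (mfderiv (𝓡 M) (𝓡 M) e.symm y : E M →L[ℝ] E M) = fderiv ℝ (e.symm.trans e') y := by
  rw [← mfderiv_eq_fderiv]
  exact (mfderiv_comp (I := 𝓡 M) (I' := 𝓡 M) (I'' := 𝓡 M) y
    ((contMDiffAt_of_mem_maximalAtlas he' hy.2).mdifferentiableAt one_ne_zero)
    ((contMDiffAt_symm_of_mem_maximalAtlas he hy.1).mdifferentiableAt one_ne_zero)).symm

/-- A form vanishes at a point if its local representation does. -/
theorem eq_zero_of_localRep_eq_zero {h : ℕ} (ω : DForm M X h)
    (he : e ∈ IsManifold.maximalAtlas (𝓡 M) 1 X) {x : X} (hx : x ∈ e.source)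
    (h0 : localRep e ω (e x) = 0) : ω x = 0 := by
  have h1 : e.symm ∘ e =ᶠ[𝓝 x] id := by
    filter_upwards [e.open_source.mem_nhds hx] with z hz using e.left_inv hz
  have h2 := h1.mfderiv_eq (I := 𝓡 M) (I' := 𝓡 M)
  rw [mfderiv_id, mfderiv_comp x
    ((contMDiffAt_symm_of_mem_maximalAtlas he (e.map_source hx)).mdifferentiableAt one_ne_zero)
    ((contMDiffAt_of_mem_maximalAtlas he hx).mdifferentiableAt one_ne_zero)] at h2
  have h3 : (ω : X → (E M) [⋀^Fin h]→L[ℝ] ℝ) (e.symm (e x)) = ω x :=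
    ω.congr_point (e.left_inv hx)
  have h4 : (ω : X → (E M) [⋀^Fin h]→L[ℝ] ℝ) x = (localRep e ω (e x)).compContinuousLinearMap
      (mfderiv (𝓡 M) (𝓡 M) e x : E M →L[ℝ] E M) := by
    rw [← h3]
    ext v
    exact congrArg ((ω : X → (E M) [⋀^Fin h]→L[ℝ] ℝ) (e.symm (e x)))
      (funext fun i => (DFunLike.congr_fun h2 (v i)).symm)
  refine h4.trans ?_
  rw [h0]
  rfl

theorem localRep_wedgeForm {p q n : ℕ} (hn : p + q = n) (ω : DForm M X p) (η : DForm M X q)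
    (y : E M) :
    localRep e (wedgeForm hn ω η) y = wedge hn (localRep e ω y) (localRep e η y) :=
  wedge_compContinuousLinearMap hn _ _ _

/-- The exterior derivative of a form commutes with the local representation. -/
theorem localRep_dForm {h : ℕ} {k : WithTop ℕ∞} (hk : 2 ≤ k) [IsManifold (𝓡 M) k X]
    (ω : DForm M X h) (he : e ∈ IsManifold.maximalAtlas (𝓡 M) k X) {y : E M} (hy : y ∈ e.target)
    (hω : DifferentiableAt ℝ (localRep e ω) y) :
    localRep e (dForm ω) y = extDeriv (localRep e ω) y := by
  have hk1 : 1 ≤ k := one_le_two.trans hk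
  have : IsManifold (𝓡 M) 1 X := IsManifold.of_le hk1
  set c := chartAt (E M) (e.symm y) with hc
  have hck : c ∈ IsManifold.maximalAtlas (𝓡 M) k X := IsManifold.chart_mem_maximalAtlas _
  have hc1 : c ∈ IsManifold.maximalAtlas (𝓡 M) 1 X := IsManifold.maximalAtlas_subset_of_le hk1 hck
  have he1 : e ∈ IsManifold.maximalAtlas (𝓡 M) 1 X := IsManifold.maximalAtlas_subset_of_le hk1 he
  have hxc : e.symm y ∈ c.source := mem_chart_source _ _
  have hye : y ∈ (e.symm.trans c).source := ⟨hy, hxc⟩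
  set z := c (e.symm y) with hz
  have hze : z ∈ (c.symm.trans e).source := (e.symm.trans c).map_source hye
  have hTz : c.symm.trans e z = y := by
    simp [hz, c.left_inv hxc, e.right_inv hy]
  have hT : ContDiffAt ℝ k (c.symm.trans e) z :=
    (contDiffOn_transition hck he).contDiffAt ((c.symm.trans e).open_source.mem_nhds hze)
  have h1 : localRep c ω =ᶠ[𝓝 z] fun u => (localRep e ω (c.symm.trans e u)).compContinuousLinearMap
      (fderiv ℝ (c.symm.trans e) u) := by
    filter_upwards [(c.symm.trans e).open_source.mem_nhds hze] with u hu
    exact localRep_transition ω hc1 he1 hu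
  -- Naturality of `d` under pullback needs a `C^2` transition map; this is where `2 ≤ k` enters.
  have h2 : extDeriv (localRep c ω) z = (extDeriv (localRep e ω) y).compContinuousLinearMap
      (fderiv ℝ (c.symm.trans e) z) := by
    rw [h1.extDeriv_eq, extDeriv_pullback (r := k) (by rwa [hTz]) hT (by simpa using hk), hTz]
  have h3 : (fderiv ℝ (c.symm.trans e) z).comp (fderiv ℝ (e.symm.trans c) y) =
      ContinuousLinearMap.id ℝ (E M) := by
    have h4 : (c.symm.trans e) ∘ (e.symm.trans c) =ᶠ[𝓝 y] id := by
      filter_upwards [(e.symm.trans c).open_source.mem_nhds hye] with u hu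
      change e (c.symm (c (e.symm u))) = u
      exact (congrArg e (c.left_inv hu.2)).trans (e.right_inv hu.1)
    have h5 := h4.fderiv_eq (𝕜 := ℝ)
    have hS : ContDiffAt ℝ k (e.symm.trans c) y :=
      (contDiffOn_transition he hck).contDiffAt ((e.symm.trans c).open_source.mem_nhds hye)
    have hk0 : k ≠ 0 := (zero_lt_one.trans_le hk1).ne'
    rw [fderiv_id, fderiv_comp y (hT.differentiableAt hk0) (hS.differentiableAt hk0)] at h5
    exact h5
  have h6 := mfderiv_chart_comp_mfderiv_symm he1 hc1 hye
  ext v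
  change extDeriv (localRep c ω) z (fun i =>
    ((mfderiv (𝓡 M) (𝓡 M) c (e.symm y) : E M →L[ℝ] E M).comp
      (mfderiv (𝓡 M) (𝓡 M) e.symm y : E M →L[ℝ] E M)) (v i)) = _
  rw [h6, h2]
  change extDeriv (localRep e ω) y (fun i => ((fderiv ℝ (c.symm.trans e) z).comp
    (fderiv ℝ (e.symm.trans c) y)) (v i)) = _
  rw [h3]
  rfl

/-- The exterior derivative is supported in the support of the form. -/
theorem dForm_eq_zero {h : ℕ} (ω : DForm M X h) {x : X} (hx : ∀ᶠ z in 𝓝 x, ω z = 0) :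
    dForm ω x = 0 := by
  set c := chartAt (E M) x with hc
  have h1 : localRep c ω =ᶠ[𝓝 (c x)] fun _ => 0 := by
    have h2 : Tendsto c.symm (𝓝 (c x)) (𝓝 x) := by
      have := c.continuousAt_symm (c.map_source (mem_chart_source _ x))
      rw [ContinuousAt, c.left_inv (mem_chart_source _ x)] at this
      exact this
    filter_upwards [h2.eventually hx] with u hu
    unfold localRep
    rw [hu]
    rfl
  have h3 : extDeriv (localRep c ω) (c x) = 0 := by
    rw [h1.extDeriv_eq]
    ext v
    simp [extDeriv, ContinuousAlternatingMap.alternatizeUncurryFin_apply]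
  unfold dForm
  rw [← hc, h3]
  rfl

end Charts

/-! ### Test forms supported in one chart. -/

section ChartForm

theorem isCompact_symm_image {X H : Type*} [TopologicalSpace X] [TopologicalSpace H]
    {e : OpenPartialHomeomorph X H} {K : Set H} (hK : IsCompact K) (hKe : K ⊆ e.target) :
    IsCompact (e.symm '' K) :=
  hK.image_of_continuousOn (e.continuousOn_symm.mono hKe)

variable {M : ℕ} {X : Type*} [TopologicalSpace X] [ChartedSpace (E M) X]
  {e : OpenPartialHomeomorph X (E M)}

open Classical in
/-- The pullback by the chart `e` of a form on `ℝ^M`, extended by zero. -/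
def chartForm {p : ℕ} (e : OpenPartialHomeomorph X (E M)) (η : E M → (E M) [⋀^Fin p]→L[ℝ] ℝ) :
    DForm M X p :=
  fun x => if x ∈ e.source then
    (η (e x)).compContinuousLinearMap (mfderiv (𝓡 M) (𝓡 M) e x : E M →L[ℝ] E M) else 0

theorem chartForm_eq_zero {p : ℕ} {η : E M → (E M) [⋀^Fin p]→L[ℝ] ℝ} {x : X}
    (h : x ∈ e.source → η (e x) = 0) : chartForm e η x = 0 := by
  unfold chartForm
  split_ifs with hx
  · rw [h hx]
    rfl
  · rfl

theorem localRep_chartForm {p : ℕ} (η : E M → (E M) [⋀^Fin p]→L[ℝ] ℝ)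
    (he : e ∈ IsManifold.maximalAtlas (𝓡 M) 1 X) {y : E M} (hy : y ∈ e.target) :
    localRep e (chartForm e η) y = η y := by
  have h1 : chartForm e η (e.symm y) = (η y).compContinuousLinearMap
      (mfderiv (𝓡 M) (𝓡 M) e (e.symm y) : E M →L[ℝ] E M) := by
    unfold chartForm
    rw [if_pos (e.map_target hy), e.right_inv hy]
  unfold localRep
  rw [h1]
  have h2 := mfderiv_comp_mfderiv_symm he hy
  ext v
  exact congrArg (η y) (funext fun i => DFunLike.congr_fun h2 (v i))

theorem localRep_eq_zero {p : ℕ} {ω : DForm M X p} {y : E M} (h : ω (e.symm y) = 0) :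
    localRep e ω y = 0 := by
  unfold localRep
  rw [h]
  rfl

theorem chartForm_eq_zero_of_notMem {p : ℕ} {η : E M → (E M) [⋀^Fin p]→L[ℝ] ℝ} {K : Set (E M)}
    (hη : ∀ y ∉ K, η y = 0) {x : X} (hx : x ∉ e.symm '' K) : chartForm e η x = 0 :=
  chartForm_eq_zero fun hxe => hη _ fun hK => hx ⟨e x, hK, e.left_inv hxe⟩

variable [T2Space X]

/-- In a Hausdorff space the compact set `e.symm '' K` is closed, so it contains the closure of the
nonvanishing set. -/
theorem isCompact_formSupport_chartForm {p : ℕ} {η : E M → (E M) [⋀^Fin p]→L[ℝ] ℝ}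
    {K : Set (E M)} (hK : IsCompact K) (hKe : K ⊆ e.target) (hη : ∀ y ∉ K, η y = 0) :
    IsCompact (formSupport (chartForm e η)) := by
  have hc := isCompact_symm_image hK hKe
  refine hc.of_isClosed_subset isClosed_closure (closure_minimal (fun x hx => ?_) hc.isClosed)
  by_contra hcon
  exact hx (chartForm_eq_zero_of_notMem hη hcon)

theorem dForm_chartForm_eq_zero {p : ℕ} {η : E M → (E M) [⋀^Fin p]→L[ℝ] ℝ}
    {K : Set (E M)} (hK : IsCompact K) (hKe : K ⊆ e.target) (hη : ∀ y ∉ K, η y = 0)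
    {x : X} (hx : x ∉ e.symm '' K) : dForm (chartForm e η) x = 0 := by
  have hc := (isCompact_symm_image hK hKe).isClosed
  refine dForm_eq_zero _ ?_
  filter_upwards [hc.isOpen_compl.mem_nhds hx] with z hz
  exact chartForm_eq_zero_of_notMem hη hz

/-- One order is lost because the representation in another chart contains the derivative of the
transition map. Away from the domain of `e` the form vanishes locally, since `e.symm '' K` is
closed. -/
theorem isFormOfClass_chartForm {p : ℕ} {k m : WithTop ℕ∞} (hm : m + 1 ≤ k)
    [IsManifold (𝓡 M) k X] (he : e ∈ IsManifold.maximalAtlas (𝓡 M) k X)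
    {f : E M → ℝ} (hf : ContDiff ℝ k f) (c : (E M) [⋀^Fin p]→L[ℝ] ℝ)
    {K : Set (E M)} (hK : IsCompact K) (hKe : K ⊆ e.target) (hfK : ∀ y ∉ K, f y = 0) :
    IsFormOfClass k m (chartForm e fun y => f y • c) := by
  intro e' he' y hy
  have hk1 : 1 ≤ k := le_add_self.trans hm
  have hmk : m ≤ k := le_self_add.trans hm
  have : IsManifold (𝓡 M) 1 X := IsManifold.of_le hk1
  have he1 : e ∈ IsManifold.maximalAtlas (𝓡 M) 1 X := IsManifold.maximalAtlas_subset_of_le hk1 he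
  have he1' : e' ∈ IsManifold.maximalAtlas (𝓡 M) 1 X :=
    IsManifold.maximalAtlas_subset_of_le hk1 he'
  apply ContDiffAt.contDiffWithinAt
  by_cases hye : e'.symm y ∈ e.source
  · have hyT : y ∈ (e'.symm.trans e).source := ⟨hy, hye⟩
    have hT : ContDiffAt ℝ k (e'.symm.trans e) y :=
      (contDiffOn_transition he' he).contDiffAt ((e'.symm.trans e).open_source.mem_nhds hyT)
    have h1 : localRep e' (chartForm e fun y => f y • c) =ᶠ[𝓝 y] fun u =>
        f (e'.symm.trans e u) •
          c.compContinuousLinearMap (fderiv ℝ (e'.symm.trans e) u) := by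
      filter_upwards [(e'.symm.trans e).open_source.mem_nhds hyT] with u hu
      rw [localRep_transition _ he1' he1 hu,
        localRep_chartForm _ he1 ((e'.symm.trans e).map_source hu).1]
      rfl
    refine ContDiffAt.congr_of_eventuallyEq ?_ h1
    exact ((hf.contDiffAt.comp y hT).of_le hmk).smul
      ((contDiff_compContinuousLinearMap c).contDiffAt.comp y (hT.fderiv_right hm))
  · have hc := (isCompact_symm_image hK hKe).isClosed
    have hyK : e'.symm y ∉ e.symm '' K := by
      rintro ⟨z, hz, hzy⟩
      exact hye (hzy ▸ e.map_target (hKe hz))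
    have h1 : localRep e' (chartForm e fun y => f y • c) =ᶠ[𝓝 y] fun _ => 0 := by
      filter_upwards [(e'.continuousAt_symm hy).eventually (hc.isOpen_compl.mem_nhds hyK)] with u hu
      exact localRep_eq_zero
        (chartForm_eq_zero_of_notMem (fun y hy => by rw [hfK y hy, zero_smul]) hu)
    exact contDiffAt_const.congr_of_eventuallyEq h1

end ChartForm

/-! ### Computing the integral in one oriented chart. -/

section Integral

variable {M : ℕ} {k : WithTop ℕ∞} {X : Type*} [TopologicalSpace X] [ChartedSpace (E M) X]

/-- Top-degree forms are multiples of the determinant. -/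
theorem map_single_comp_eq_det_mul (c : (E M) [⋀^Fin M]→L[ℝ] ℝ) (A : E M →L[ℝ] E M) :
    c (fun i => A (EuclideanSpace.single i (1 : ℝ))) =
      A.det * c (fun i => EuclideanSpace.single i (1 : ℝ)) := by
  let b := (EuclideanSpace.basisFun (Fin M) ℝ).toBasis
  have hb : (b : Fin M → E M) = fun i => EuclideanSpace.single i (1 : ℝ) := by
    funext i
    simp [b]
  have h1 : ∀ v, c v = c b * b.det v := fun v =>
    DFunLike.congr_fun (c.toAlternatingMap.eq_smul_basis_det b) v
  have h2 : b.det (fun i => A (EuclideanSpace.single i (1 : ℝ))) = A.det := by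
    have := b.det_comp A.toLinearMap b
    rw [b.det_self, mul_one] at this
    rw [hb] at this
    exact this
  rw [h1, h2, hb, mul_comm]

/-- Change of variables: each term of the integral may be computed in any oriented chart containing
the support of the form. -/
theorem ManifoldOrientation.setIntegral_chart_eq (hk : 1 ≤ k) [IsManifold (𝓡 M) k X]
    (o : ManifoldOrientation M k X) {e₀ e : OpenPartialHomeomorph X (E M)} (he₀ : e₀ ∈ o.charts)
    (he : e ∈ o.charts) (ω : DForm M X M) (hω : ∀ x ∉ e₀.source, ω x = 0)
    (ρ : X → ℝ) (hρ : ∀ x ∉ e.source, ρ x = 0) :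
    (∫ y in e.target,
      ρ (e.symm y) * localRep e ω y (fun i => EuclideanSpace.single i (1 : ℝ))) =
    ∫ y in e₀.target,
      ρ (e₀.symm y) * localRep e₀ ω y (fun i => EuclideanSpace.single i (1 : ℝ)) := by
  have : IsManifold (𝓡 M) 1 X := IsManifold.of_le hk
  have hk0 : k ≠ 0 := (zero_lt_one.trans_le hk).ne'
  have hc₀ := o.charts_subset he₀
  have hc := o.charts_subset he
  have hc₀' := IsManifold.maximalAtlas_subset_of_le hk hc₀
  have hc' := IsManifold.maximalAtlas_subset_of_le hk hc
  set T := e₀.symm.trans e with hT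
  -- Both integrals reduce to the overlap of the charts: off it the first vanishes because of `ω`,
  -- the second because of `ρ`.
  have h1 : (∫ y in e.target,
      ρ (e.symm y) * localRep e ω y (fun i => EuclideanSpace.single i (1 : ℝ))) =
      ∫ y in T.target,
        ρ (e.symm y) * localRep e ω y (fun i => EuclideanSpace.single i (1 : ℝ)) := by
    refine setIntegral_eq_of_subset_of_forall_sdiff_eq_zero e.open_target.measurableSet
      (fun y hy => hy.1) fun y hy => ?_
    have : ω (e.symm y) = 0 := hω _ fun h => hy.2 ⟨hy.1, h⟩
    rw [localRep_eq_zero this]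
    simp
  have h2 : (∫ y in e₀.target,
      ρ (e₀.symm y) * localRep e₀ ω y (fun i => EuclideanSpace.single i (1 : ℝ))) =
      ∫ y in T.source,
        ρ (e₀.symm y) * localRep e₀ ω y (fun i => EuclideanSpace.single i (1 : ℝ)) := by
    refine setIntegral_eq_of_subset_of_forall_sdiff_eq_zero e₀.open_target.measurableSet
      (fun y hy => hy.1) fun y hy => ?_
    have : ρ (e₀.symm y) = 0 := hρ _ fun h => hy.2 ⟨hy.1, h⟩
    rw [this, zero_mul]
  rw [h1, h2, ← T.image_source_eq_target,
    integral_image_eq_integral_abs_det_fderiv_smul volume T.open_source.measurableSet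
      (f' := fderiv ℝ T)
      (fun y hy => (((contDiffOn_transition hc₀ hc).contDiffAt
        (T.open_source.mem_nhds hy)).differentiableAt hk0).hasFDerivAt.hasFDerivWithinAt)
      T.injOn]
  refine setIntegral_congr_fun T.open_source.measurableSet fun y hy => ?_
  -- Positivity removes the absolute value, so the Jacobian of the substitution matches the
  -- determinant from the pullback.
  have hdet := o.det_pos e₀ he₀ e he y hy
  have h3 : e.symm (T y) = e₀.symm y := e.left_inv hy.2
  simp only [smul_eq_mul]
  rw [h3, localRep_transition ω hc₀' hc' hy, abs_of_pos hdet,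
    ContinuousAlternatingMap.compContinuousLinearMap_apply]
  have h4 := map_single_comp_eq_det_mul (localRep e ω (T y)) (fderiv ℝ T y)
  change _ = ρ (e₀.symm y) * (localRep e ω (T y)
    (fun i => fderiv ℝ T y (EuclideanSpace.single i (1 : ℝ))))
  rw [h4]
  ring

variable [T2Space X] [ParacompactSpace X]

/-- The integral of a form supported in the domain of an oriented chart is computed in that
chart. -/
theorem ManifoldOrientation.integral_eq_setIntegral (hk : 1 ≤ k) [IsManifold (𝓡 M) k X]
    (o : ManifoldOrientation M k X) {e₀ : OpenPartialHomeomorph X (E M)} (he₀ : e₀ ∈ o.charts)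
    (ω : DForm M X M) {K : Set (E M)} (hK : IsCompact K) (hKe : K ⊆ e₀.target)
    (hω : ∀ x ∉ e₀.symm '' K, ω x = 0)
    (hcont : ContinuousOn
      (fun y => localRep e₀ ω y (fun i => EuclideanSpace.single i (1 : ℝ))) e₀.target) :
    o.integral ω =
      ∫ y in e₀.target, localRep e₀ ω y (fun i => EuclideanSpace.single i (1 : ℝ)) := by
  set F : E M → ℝ := fun y => localRep e₀ ω y (fun i => EuclideanSpace.single i (1 : ℝ)) with hF
  have hK' := isCompact_symm_image hK hKe
  have hFK : ∀ y ∈ e₀.target, y ∉ K → F y = 0 := by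
    intro y hy hyK
    have : ω (e₀.symm y) = 0 := by
      refine hω _ ?_
      rintro ⟨z, hz, hzy⟩
      exact hyK (e₀.symm.injOn (hKe hz) hy hzy ▸ hz)
    simp only [hF]
    rw [localRep_eq_zero this]
    rfl
  have hterm : ∀ e : o.charts, (∫ y in e.1.target, o.partition e (e.1.symm y) *
      localRep e.1 ω y (fun i => EuclideanSpace.single i (1 : ℝ))) =
      ∫ y in e₀.target, o.partition e (e₀.symm y) * F y := by
    intro e
    refine o.setIntegral_chart_eq hk he₀ e.2 ω (fun x hx => hω x ?_) _ fun x hx => ?_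
    · rintro ⟨z, hz, rfl⟩
      exact hx (e₀.map_target (hKe hz))
    · by_contra h
      exact hx (o.exists_partitionOfUnity.choose_spec e (subset_tsupport _ h))
  -- Local finiteness leaves finitely many `ρ_e` meeting the support, so sum and integral may be
  -- exchanged.
  have hfin : {e : o.charts | (Function.support (o.partition e) ∩ e₀.symm '' K).Nonempty}.Finite :=
    o.partition.locallyFinite.finite_nonempty_inter_compact hK'
  unfold ManifoldOrientation.integral
  simp only [hterm]
  rw [finsum_eq_sum_of_support_subset (s := hfin.toFinset)]
  · rw [← integral_finsetSum]
    · refine setIntegral_congr_fun e₀.open_target.measurableSet fun y hy => ?_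
      simp only [← Finset.sum_mul]
      by_cases hyK : y ∈ K
      · have h1 := o.partition.sum_eq_one (mem_univ (e₀.symm y))
        rw [finsum_eq_sum_of_support_subset (s := hfin.toFinset)] at h1
        · rw [h1, one_mul]
        · intro e he
          simp only [Finite.coe_toFinset, mem_ofPred_eq]
          exact ⟨e₀.symm y, he, y, hyK, rfl⟩
      · exact (congrArg _ (hFK y hy hyK)).trans ((mul_zero _).trans (hFK y hy hyK).symm)
    · intro e _
      have h2 : ContinuousOn (fun y => o.partition e (e₀.symm y) * F y) e₀.target :=
        ((o.partition e).continuous.comp_continuousOn e₀.continuousOn_symm).mul hcont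
      refine IntegrableOn.of_forall_sdiff_eq_zero ((h2.mono hKe).integrableOn_compact hK)
        e₀.open_target.measurableSet fun y hy => ?_
      rw [hFK y hy.1 hy.2, mul_zero]
  · intro e he
    simp only [Finite.coe_toFinset, mem_ofPred_eq]
    by_contra hcon
    refine he (setIntegral_eq_zero_of_forall_eq_zero fun y hy => ?_)
    by_cases hyK : y ∈ K
    · have : o.partition e (e₀.symm y) = 0 := by
        by_contra h
        exact hcon ⟨e₀.symm y, h, y, hyK, rfl⟩
      rw [this, zero_mul]
    · rw [hFK y hy hyK, mul_zero]

end Integral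

/-! ### Chart independence of superdensity. -/

section Density

variable {M : ℕ}

/-- A map whose Jacobian determinant is bounded on a measurable set enlarges the outer measure of
its subsets by a bounded factor only. -/
theorem volume_image_le_of_abs_det_le {S : E M → E M} {D G : Set (E M)} (hD : MeasurableSet D)
    (hS : ∀ y ∈ D, DifferentiableAt ℝ S y) {C : ℝ} (hC : ∀ y ∈ D, |(fderiv ℝ S y).det| ≤ C)
    (hG : G ⊆ D) : volume (S '' G) ≤ ENNReal.ofReal C * volume G := by
  -- `G` need not be measurable, so the area estimate is applied to a measurable hull cut down to
  -- `D`.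
  set G' := toMeasurable volume G ∩ D with hG'
  have hm : MeasurableSet G' := (measurableSet_toMeasurable _ _).inter hD
  calc volume (S '' G) ≤ volume (S '' G') :=
        measure_mono (image_mono (subset_inter (subset_toMeasurable _ _) hG))
    _ ≤ ∫⁻ y in G', ENNReal.ofReal |(fderiv ℝ S y).det| :=
        addHaar_image_le_lintegral_abs_det_fderiv volume hm
          fun y hy => (hS y hy.2).hasFDerivAt.hasFDerivWithinAt
    _ ≤ ∫⁻ _ in G', ENNReal.ofReal C :=
        setLIntegral_mono measurable_const fun y hy => ENNReal.ofReal_le_ofReal (hC y hy.2)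
    _ = ENNReal.ofReal C * volume G' := setLIntegral_const _ _
    _ ≤ ENNReal.ofReal C * volume G := by
        refine mul_le_mul_right ?_ _
        exact (measure_mono inter_subset_left).trans (measure_toMeasurable G).le

variable {X : Type*} [TopologicalSpace X] [ChartedSpace (E M) X] [IsManifold (𝓡 M) 1 X]

/-- The density condition does not depend on the `C^1` chart. -/
theorem isLittleO_density_chart {m : ℝ} {A : Set X} {Q : X}
    {e e₀ : OpenPartialHomeomorph X (E M)}
    (he : e ∈ IsManifold.maximalAtlas (𝓡 M) 1 X) (he₀ : e₀ ∈ IsManifold.maximalAtlas (𝓡 M) 1 X)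
    (hQ : Q ∈ e.source) (hQ₀ : Q ∈ e₀.source)
    (h : (fun r : ℝ => (volume (Metric.ball (e Q) r \ e '' (A ∩ e.source))).toReal)
      =o[𝓝[>] 0] fun r : ℝ => r ^ m) :
    (fun r : ℝ => (volume (Metric.ball (e₀ Q) r \ e₀ '' (A ∩ e₀.source))).toReal)
      =o[𝓝[>] 0] fun r : ℝ => r ^ m := by
  set T := e₀.symm.trans e with hT
  have hTs : T.symm = e.symm.trans e₀ := by
    rw [hT, OpenPartialHomeomorph.trans_symm_eq_symm_trans_symm]
    simp
  have hyT : e₀ Q ∈ T.source :=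
    ⟨e₀.map_source hQ₀, by simpa [e₀.left_inv hQ₀] using hQ⟩
  have hTy : T (e₀ Q) = e Q := by simp [hT, e₀.left_inv hQ₀]
  have hzT : e Q ∈ T.target := hTy ▸ T.map_source hyT
  have hTC : ContDiffAt ℝ 1 T (e₀ Q) :=
    (contDiffOn_transition he₀ he).contDiffAt (T.open_source.mem_nhds hyT)
  have hSC : ContDiffOn ℝ 1 T.symm T.target := by
    have := contDiffOn_transition he he₀
    rw [← hTs] at this
    exact this
  obtain ⟨L, t, ht, hL⟩ := hTC.exists_lipschitzOnWith
  have hdet : ContinuousAt (fun y => |(fderiv ℝ T.symm y).det|) (e Q) := by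
    have h1 : ContinuousAt (fderiv ℝ T.symm) (e Q) :=
      ((hSC.contDiffAt (T.open_target.mem_nhds hzT)).fderiv_right (m := 0) le_rfl).continuousAt
    exact (ContinuousLinearMap.continuous_det.continuousAt.comp h1).abs
  obtain ⟨δ, hδ, hball⟩ := Metric.eventually_nhds_iff_ball.1
    ((hdet.eventually_lt continuousAt_const (lt_add_one _)).and (T.open_target.mem_nhds hzT))
  set C := |(fderiv ℝ T.symm (e Q)).det| + 1 with hC
  have hC0 : 0 ≤ C := by positivity
  set κ : ℝ := L + 1 with hκ
  have hκ0 : 0 < κ := by positivity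
  obtain ⟨δ', hδ', hball'⟩ := Metric.mem_nhds_iff.1
    (inter_mem ht (T.open_source.mem_nhds hyT))
  have hlim : Tendsto (fun r : ℝ => κ * r) (𝓝[>] 0) (𝓝[>] 0) := by
    refine tendsto_nhdsWithin_iff.2 ⟨?_, ?_⟩
    · have : Tendsto (fun r : ℝ => κ * r) (𝓝 0) (𝓝 (κ * 0)) := tendsto_id.const_mul κ
      rw [mul_zero] at this
      exact this.mono_left nhdsWithin_le_nhds
    · filter_upwards [self_mem_nhdsWithin] with r hr using mul_pos hκ0 hr
  -- The transition map `T` is Lipschitz near the centre, so it sends `B_r` into `B_{κr}` and the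
  -- bad set into the bad set of the other chart. Going back, `T.symm` enlarges volume by at most
  -- the local Jacobian bound `C`.
  have hO : (fun r : ℝ => (volume (Metric.ball (e₀ Q) r \ e₀ '' (A ∩ e₀.source))).toReal)
      =O[𝓝[>] 0]
      fun r : ℝ => (volume (Metric.ball (e Q) (κ * r) \ e '' (A ∩ e.source))).toReal := by
    refine IsBigO.of_bound C ?_
    filter_upwards [self_mem_nhdsWithin, Ioo_mem_nhdsGT hδ',
      Ioo_mem_nhdsGT (div_pos hδ hκ0)] with r hr hr1 hr2
    have hrδ : κ * r < δ := by
      rw [mul_comm]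
      exact (lt_div_iff₀ hκ0).1 hr2.2
    set G := Metric.ball (e Q) (κ * r) \ e '' (A ∩ e.source) with hG
    have hsub : Metric.ball (e₀ Q) r \ e₀ '' (A ∩ e₀.source) ⊆ T.symm '' G := by
      rintro y ⟨hy, hyA⟩
      have hy' := hball' (Metric.ball_subset_ball hr1.2.le hy)
      refine ⟨T y, ⟨?_, ?_⟩, T.left_inv hy'.2⟩
      · rw [Metric.mem_ball, ← hTy]
        refine (hL.dist_le_mul y hy'.1 _ (mem_of_mem_nhds ht)).trans_lt ?_
        have h1 : dist y (e₀ Q) < r := hy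
        have h2 : (0 : ℝ) ≤ L := L.2
        have hr0 : 0 < r := hr
        nlinarith [mul_le_mul_of_nonneg_left h1.le h2]
      · rintro ⟨x, hx, hxy⟩
        have h3 : x = e₀.symm y := e.injOn hx.2 hy'.2.2 hxy
        exact hyA ⟨x, ⟨hx.1, h3 ▸ e₀.map_target hy'.2.1⟩, h3 ▸ e₀.right_inv hy'.2.1⟩
    have hvol : volume (T.symm '' G) ≤ ENNReal.ofReal C * volume G := by
      refine volume_image_le_of_abs_det_le (D := Metric.ball (e Q) δ) measurableSet_ball
        (fun y hy => ?_) (fun y hy => (hball y hy).1.le)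
        (sdiff_subset.trans (Metric.ball_subset_ball hrδ.le))
      exact (hSC.contDiffAt (T.open_target.mem_nhds (hball y hy).2)).differentiableAt one_ne_zero
    have hfin : volume G ≠ ⊤ := ((measure_mono sdiff_subset).trans_lt measure_ball_lt_top).ne
    have h4 := ENNReal.toReal_mono (ENNReal.mul_ne_top ENNReal.ofReal_ne_top hfin)
      ((measure_mono hsub).trans hvol)
    rw [ENNReal.toReal_mul, ENNReal.toReal_ofReal hC0] at h4
    rwa [Real.norm_of_nonneg ENNReal.toReal_nonneg, Real.norm_of_nonneg ENNReal.toReal_nonneg]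
  refine (hO.trans_isLittleO (h.comp_tendsto hlim)).trans_isBigO ?_
  refine IsBigO.of_bound (κ ^ m) ?_
  filter_upwards [self_mem_nhdsWithin] with r hr
  have hr0 : (0 : ℝ) < r := hr
  rw [Function.comp_apply, Real.mul_rpow hκ0.le hr0.le, norm_mul,
    Real.norm_of_nonneg (Real.rpow_nonneg hκ0.le _)]

end Density

/-! ### The scaling argument on an open subset of Euclidean space. -/

section Euclidean

variable {M : ℕ}

theorem integrableOn_of_continuousOn_of_eq_zero {U K : Set (E M)} (hU : IsOpen U)
    (hK : IsCompact K) (hKU : K ⊆ U) {F : E M → ℝ} (hF : ContinuousOn F U)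
    (h0 : ∀ y ∉ K, F y = 0) : IntegrableOn F U :=
  IntegrableOn.of_forall_sdiff_eq_zero ((hF.mono hKU).integrableOn_compact hK) hU.measurableSet
    fun y hy => h0 y hy.2

/-- Only the coefficients are rescaled and the arguments are not pulled back, so a single factor `a`
appears, whatever the degree. -/
theorem extDeriv_comp_smul_sub {p : ℕ} {η : E M → (E M) [⋀^Fin p]→L[ℝ] ℝ}
    (hη : Differentiable ℝ η) (a : ℝ) (y₀ y : E M) :
    extDeriv (fun z => η (a • (z - y₀))) y = a • extDeriv η (a • (y - y₀)) := by
  have h1 : HasFDerivAt (fun z : E M => a • (z - y₀)) (a • ContinuousLinearMap.id ℝ (E M)) y :=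
    ((hasFDerivAt_id y).sub_const y₀).const_smul a
  have h2 : fderiv ℝ (fun z => η (a • (z - y₀))) y = a • fderiv ℝ η (a • (y - y₀)) := by
    refine ((hη (a • (y - y₀))).hasFDerivAt.comp y h1).fderiv.trans ?_
    ext v w
    simp
  rw [extDeriv, extDeriv, h2, ContinuousAlternatingMap.alternatizeUncurryFin_smul]

theorem continuous_extDeriv {p : ℕ} {η : E M → (E M) [⋀^Fin p]→L[ℝ] ℝ} (hη : ContDiff ℝ 1 η) :
    Continuous (extDeriv η) :=
  (ContinuousAlternatingMap.alternatizeUncurryFinCLM ℝ (E M) ℝ).continuous.comp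
    (hη.continuous_fderiv one_ne_zero)

/-- The integral of a function that vanishes off a (not necessarily measurable) set of finite
measure. -/
theorem norm_setIntegral_le_of_eq_zero_off {U S : Set (E M)} {F : E M → ℝ} {C : ℝ} (hC : 0 ≤ C)
    (hS : volume S ≠ ⊤) (hF : ∀ y ∈ S, ‖F y‖ ≤ C) (h0 : ∀ y ∉ S, F y = 0) :
    ‖∫ y in U, F y‖ ≤ C * (volume S).toReal := by
  set N := toMeasurable volume S with hN
  have hNi : Integrable (N.indicator fun _ => C) (volume : Measure (E M)) := by
    refine (integrable_indicator_iff (measurableSet_toMeasurable _ _)).2 (integrableOn_const ?_)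
    rwa [measure_toMeasurable]
  have hNp : ∀ y, 0 ≤ N.indicator (fun _ => C) y := fun y => indicator_nonneg (fun _ _ => hC) y
  calc ‖∫ y in U, F y‖ ≤ ∫ y in U, N.indicator (fun _ => C) y := by
        refine norm_integral_le_of_norm_le hNi.integrableOn (Eventually.of_forall fun y => ?_)
        by_cases hy : y ∈ S
        · rw [indicator_of_mem (subset_toMeasurable _ _ hy)]
          exact hF y hy
        · rw [h0 y hy, norm_zero]
          exact hNp y
    _ ≤ ∫ y, N.indicator (fun _ => C) y :=
        setIntegral_le_integral hNi (Eventually.of_forall hNp)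
    _ = C * (volume S).toReal := by
        rw [integral_indicator_const _ (measurableSet_toMeasurable _ _), measureReal_def,
          measure_toMeasurable, smul_eq_mul, mul_comm]

/-- A smooth function that is `1` on the ball of radius `1/4` and vanishes off the ball of radius
`1/2`. -/
def unitBump (M : ℕ) : ContDiffBump (0 : E M) := ⟨1 / 4, 1 / 2, by norm_num, by norm_num⟩

/-- The bump function `unitBump` transported to the ball of radius `r` about `y₀`. -/
def scaledBump (y₀ : E M) (r : ℝ) (y : E M) : ℝ := unitBump M (r⁻¹ • (y - y₀))

theorem norm_inv_smul_sub {r : ℝ} (hr : 0 < r) (y₀ y : E M) :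
    ‖r⁻¹ • (y - y₀)‖ = dist y y₀ / r := by
  rw [norm_smul, norm_inv, Real.norm_of_nonneg hr.le, dist_eq_norm, inv_mul_eq_div]

theorem contDiff_scaledBump (y₀ : E M) (r : ℝ) (n : ℕ∞) : ContDiff ℝ n (scaledBump y₀ r) :=
  (unitBump M).contDiff.comp ((contDiff_id.sub contDiff_const).const_smul r⁻¹)

theorem scaledBump_nonneg (y₀ : E M) (r : ℝ) (y : E M) : 0 ≤ scaledBump y₀ r y :=
  (unitBump M).nonneg

theorem scaledBump_eq_zero {y₀ : E M} {r : ℝ} (hr : 0 < r) {y : E M}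
    (hy : y ∉ Metric.ball y₀ r) : scaledBump y₀ r y = 0 := by
  refine (unitBump M).zero_of_le_dist ?_
  rw [dist_zero_right, norm_inv_smul_sub hr]
  have h1 : 1 ≤ dist y y₀ / r := (one_le_div hr).2 (not_lt.1 hy)
  change (1 / 2 : ℝ) ≤ _
  linarith

theorem scaledBump_eq_one {y₀ : E M} {r : ℝ} (hr : 0 < r) {y : E M}
    (hy : y ∈ Metric.ball y₀ (r / 4)) : scaledBump y₀ r y = 1 := by
  refine (unitBump M).one_of_mem_closedBall ?_
  rw [mem_closedBall_zero_iff, norm_inv_smul_sub hr]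
  change _ ≤ (1 / 4 : ℝ)
  rw [div_le_iff₀ hr]
  have := Metric.mem_ball.1 hy
  linarith

theorem contDiff_unitBump_smul {p : ℕ} (c : (E M) [⋀^Fin p]→L[ℝ] ℝ) :
    ContDiff ℝ 1 fun z => unitBump M z • c :=
  (unitBump M).contDiff.smul contDiff_const

theorem extDeriv_scaledBump_smul {p : ℕ} (c : (E M) [⋀^Fin p]→L[ℝ] ℝ) (y₀ : E M) (r : ℝ)
    (y : E M) : extDeriv (fun z => scaledBump y₀ r z • c) y =
      r⁻¹ • extDeriv (fun z => unitBump M z • c) (r⁻¹ • (y - y₀)) :=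
  extDeriv_comp_smul_sub ((contDiff_unitBump_smul c).differentiable one_ne_zero) r⁻¹ y₀ y

theorem extDeriv_unitBump_smul_eq_zero {p : ℕ} (c : (E M) [⋀^Fin p]→L[ℝ] ℝ) {z : E M}
    (hz : 1 ≤ ‖z‖) : extDeriv (fun z => unitBump M z • c) z = 0 := by
  have h1 : (fun z => unitBump M z • c) =ᶠ[𝓝 z] fun _ => 0 := by
    have : (Metric.closedBall (0 : E M) (1 / 2))ᶜ ∈ 𝓝 z := by
      refine Metric.isClosed_closedBall.isOpen_compl.mem_nhds ?_
      rw [mem_compl_iff, mem_closedBall_zero_iff]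
      linarith
    filter_upwards [this] with u hu
    rw [mem_compl_iff, Metric.mem_closedBall, not_le] at hu
    rw [(unitBump M).zero_of_le_dist hu.le, zero_smul]
  rw [h1.extDeriv_eq]
  ext v
  simp [extDeriv, ContinuousAlternatingMap.alternatizeUncurryFin_apply]

theorem toReal_volume_ball_div_four (y₀ : E M) {r : ℝ} (hr : 0 < r) :
    (volume (Metric.ball y₀ (r / 4))).toReal =
      (1 / 4) ^ M * (volume (Metric.ball (0 : E M) 1)).toReal * r ^ M := by
  rw [Measure.addHaar_ball_of_pos _ _ (by positivity), ENNReal.toReal_mul,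
    ENNReal.toReal_ofReal (by positivity), finrank_euclideanSpace, Fintype.card_fin,
    div_eq_mul_one_div, mul_pow]
  ring

/-- Lower bound for the integral of a bump function against a function bounded below. -/
theorem mul_pow_le_setIntegral_scaledBump {U : Set (E M)} (hU : IsOpen U) {y₀ : E M} {r : ℝ}
    (hr : 0 < r) (hKU : Metric.closedBall y₀ r ⊆ U) {G : E M → ℝ} (hG : ContinuousOn G U) {a : ℝ}
    (ha : 0 ≤ a) (hGa : ∀ y ∈ Metric.ball y₀ r, a ≤ G y) :
    a * ((1 / 4) ^ M * (volume (Metric.ball (0 : E M) 1)).toReal) * r ^ M ≤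
      ∫ y in U, scaledBump y₀ r y * G y := by
  have hb' : Metric.ball y₀ (r / 4) ⊆ Metric.ball y₀ r := Metric.ball_subset_ball (by linarith)
  have hb : Metric.ball y₀ (r / 4) ⊆ U := (hb'.trans Metric.ball_subset_closedBall).trans hKU
  calc a * ((1 / 4) ^ M * (volume (Metric.ball (0 : E M) 1)).toReal) * r ^ M
      = ∫ y in U, (Metric.ball y₀ (r / 4)).indicator (fun _ => a) y := by
        rw [setIntegral_indicator measurableSet_ball, inter_eq_self_of_subset_right hb,
          setIntegral_const, measureReal_def, toReal_volume_ball_div_four y₀ hr, smul_eq_mul]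
        ring
    _ ≤ ∫ y in U, scaledBump y₀ r y * G y := by
        refine setIntegral_mono_on ?_ ?_ hU.measurableSet fun y hy => ?_
        · exact ((integrable_indicator_iff measurableSet_ball).2
            (integrableOn_const measure_ball_lt_top.ne)).integrableOn
        · refine integrableOn_of_continuousOn_of_eq_zero hU (isCompact_closedBall y₀ r) hKU
            (((contDiff_scaledBump y₀ r 0).continuous.continuousOn).mul hG) fun y hy => ?_
          rw [scaledBump_eq_zero hr fun h => hy (Metric.ball_subset_closedBall h), zero_mul]
        · by_cases hyr : y ∈ Metric.ball y₀ r
          · have h1 := hGa y hyr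
            by_cases hy4 : y ∈ Metric.ball y₀ (r / 4)
            · rw [indicator_of_mem hy4, scaledBump_eq_one hr hy4, one_mul]
              exact h1
            · rw [indicator_of_notMem hy4]
              exact mul_nonneg (scaledBump_nonneg _ _ _) (ha.trans h1)
          · rw [scaledBump_eq_zero hr hyr, indicator_of_notMem fun h => hyr (hb' h), zero_mul]

/-- Upper bound for the pairing of a form with the exterior derivative of a rescaled bump. -/
theorem exists_norm_setIntegral_wedge_extDeriv_le {h p : ℕ} (hM : h + (p + 1) = M)
    {U : Set (E M)} {y₀ : E M} {R : ℝ} (hR : 0 < R) (hRU : Metric.closedBall y₀ R ⊆ U)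
    {γ : E M → (E M) [⋀^Fin h]→L[ℝ] ℝ} (hγ : ContinuousOn γ U) (c : (E M) [⋀^Fin p]→L[ℝ] ℝ)
    {Z : Set (E M)} (hZ : ∀ y ∈ Z, γ y = 0) :
    ∃ C : ℝ, 0 ≤ C ∧ ∀ r, 0 < r → r < R →
      ‖∫ y in U, wedge hM (γ y) (extDeriv (fun z => scaledBump y₀ r z • c) y)
        (fun i => EuclideanSpace.single i (1 : ℝ))‖ ≤
      r⁻¹ * C * (volume (Metric.ball y₀ r \ Z)).toReal := by
  -- Treating `y` and the rescaled point `(y - y₀) / r` as independent variables in a compact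
  -- product makes `C` uniform in `r`.
  obtain ⟨C, hC⟩ : ∃ C : ℝ, ∀ yz ∈ Metric.closedBall y₀ R ×ˢ Metric.closedBall (0 : E M) 1,
      ‖wedge hM (γ yz.1) (extDeriv (fun z => unitBump M z • c) yz.2)
        (fun i => EuclideanSpace.single i (1 : ℝ))‖ ≤ C := by
    refine ((isCompact_closedBall _ _).prod (isCompact_closedBall _ _)).exists_bound_of_continuousOn
      (continuousOn_wedge_apply hM ?_ ?_ _)
    · exact (hγ.mono hRU).comp continuousOn_fst fun yz hyz => hyz.1
    · exact ((continuous_extDeriv (contDiff_unitBump_smul c)).comp continuous_snd).continuousOn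
  have hC0 : 0 ≤ C := (norm_nonneg _).trans
    (hC (y₀, 0) ⟨Metric.mem_closedBall_self hR.le, Metric.mem_closedBall_self zero_le_one⟩)
  refine ⟨C, hC0, fun r hr hrR => ?_⟩
  simp only [extDeriv_scaledBump_smul, wedge_smul_right_apply]
  refine norm_setIntegral_le_of_eq_zero_off (by positivity)
    ((measure_mono sdiff_subset).trans_lt measure_ball_lt_top).ne (fun y hy => ?_) fun y hy => ?_
  · rw [norm_mul, norm_inv, Real.norm_of_nonneg hr.le]
    refine mul_le_mul_of_nonneg_left (hC (y, r⁻¹ • (y - y₀)) ⟨?_, ?_⟩) (by positivity)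
    · exact Metric.closedBall_subset_closedBall hrR.le (Metric.ball_subset_closedBall hy.1)
    · rw [mem_closedBall_zero_iff, norm_inv_smul_sub hr]
      exact (div_le_one hr).2 (Metric.mem_ball.1 hy.1).le
  · by_cases hyr : y ∈ Metric.ball y₀ r
    · have hyZ : y ∈ Z := by
        by_contra hcon
        exact hy ⟨hyr, hcon⟩
      rw [hZ y hyZ, wedge_zero_left]
      simp
    · rw [extDeriv_unitBump_smul_eq_zero, wedge_zero_right]
      · simp
      · rw [norm_inv_smul_sub hr]
        exact (one_le_div hr).2 (not_lt.1 hyr)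

/-- If `κ r^M ≤ C r⁻¹ v(r)` for small `r` and `v(r) = o(r^(M+1))`, then `κ ≤ 0`. -/
theorem nonpos_of_mul_pow_le {v : ℝ → ℝ} (hv0 : ∀ r, 0 ≤ v r) {κ C : ℝ} (hC : 0 ≤ C)
    (hv : v =o[𝓝[>] 0] fun r : ℝ => r ^ ((M : ℝ) + 1))
    (h : ∀ᶠ r in 𝓝[>] (0 : ℝ), κ * r ^ M ≤ C * (r⁻¹ * v r)) : κ ≤ 0 := by
  by_contra! hκ
  -- With this choice `C` times the bound is `κ * C / (2 * (C + 1))`, strictly below `κ` even when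
  -- `C = 0`.
  have hε : 0 < κ / (2 * (C + 1)) := by positivity
  obtain ⟨r, hr0, hk, hr⟩ := ((eventually_mem_nhdsWithin (a := (0 : ℝ)) (s := Ioi 0)).and
    (h.and (hv.def hε))).exists
  have hr0' : 0 < r := hr0
  rw [Real.norm_of_nonneg (hv0 r), Real.norm_of_nonneg (by positivity),
    Real.rpow_add hr0', Real.rpow_natCast, Real.rpow_one] at hr
  have hrM : 0 < r ^ M := by positivity
  have h1 : r⁻¹ * v r ≤ κ / (2 * (C + 1)) * r ^ M := by
    rw [inv_mul_le_iff₀ hr0']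
    linarith
  have h2 : κ * r ^ M ≤ κ * r ^ M * (C / (2 * (C + 1))) := by
    refine (hk.trans (mul_le_mul_of_nonneg_left h1 hC)).trans_eq ?_
    ring
  have h4 : C / (2 * (C + 1)) < 1 := by
    rw [div_lt_one (by positivity)]
    linarith
  exact absurd h2 (not_le.2 (mul_lt_of_lt_one_right (by positivity) h4))

/-- The local form of the theorem, on an open subset of `ℝ^M`. -/
theorem wedge_eq_zero_of_density {h p : ℕ} (hM : h + 1 + p = M) (hM' : h + (p + 1) = M)
    {U : Set (E M)} (hU : IsOpen U) {y₀ : E M} (hy₀ : y₀ ∈ U)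
    {γ : E M → (E M) [⋀^Fin h]→L[ℝ] ℝ} (hγ : ContinuousOn γ U)
    {δ : E M → (E M) [⋀^Fin (h + 1)]→L[ℝ] ℝ} (hδ : ContinuousOn δ U)
    (c : (E M) [⋀^Fin p]→L[ℝ] ℝ)
    (hint : ∀ f : E M → ℝ, (∀ n : ℕ∞, ContDiff ℝ n f) → ∀ K : Set (E M), IsCompact K → K ⊆ U →
      (∀ y ∉ K, f y = 0) →
      (∫ y in U, wedge hM' (γ y) (extDeriv (fun z => f z • c) y)
        (fun i => EuclideanSpace.single i (1 : ℝ))) =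
      (-1 : ℝ) ^ (h + 1) *
        ∫ y in U, wedge hM (δ y) (f y • c) (fun i => EuclideanSpace.single i (1 : ℝ)))
    {Z : Set (E M)} (hZ : ∀ y ∈ Z, γ y = 0)
    (hdens : (fun r : ℝ => (volume (Metric.ball y₀ r \ Z)).toReal)
      =o[𝓝[>] 0] fun r : ℝ => r ^ ((M : ℝ) + 1)) :
    wedge hM (δ y₀) c (fun i => EuclideanSpace.single i (1 : ℝ)) = 0 := by
  obtain ⟨g, hg⟩ : ∃ g : E M → ℝ, g = fun y =>
    wedge hM (δ y) c (fun i => EuclideanSpace.single i (1 : ℝ)) := ⟨_, rfl⟩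
  have hgc : ContinuousOn g U := by
    rw [hg]
    exact continuousOn_wedge_apply hM hδ continuousOn_const _
  suffices hs : g y₀ = 0 by rwa [hg] at hs
  by_contra hs0
  obtain ⟨R, hR, hRU⟩ := Metric.nhds_basis_closedBall.mem_iff.1 (hU.mem_nhds hy₀)
  obtain ⟨C, hC0, hC⟩ := exists_norm_setIntegral_wedge_extDeriv_le hM' hR hRU hγ c hZ
  have hs2 : 0 < g y₀ ^ 2 / 2 := by positivity
  -- Multiplying by `g y₀` avoids splitting on its sign: the product is near `g y₀ ^ 2 > 0`.
  have hgs : ∀ᶠ y in 𝓝 y₀, g y₀ ^ 2 / 2 < g y₀ * g y := by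
    refine (continuousAt_const.mul (hgc.continuousAt (hU.mem_nhds hy₀))).eventually_const_lt ?_
    change g y₀ ^ 2 / 2 < g y₀ * g y₀
    nlinarith
  obtain ⟨R₁, hR₁, hball₁⟩ := Metric.eventually_nhds_iff_ball.1 hgs
  have hω : 0 < (volume (Metric.ball (0 : E M) 1)).toReal :=
    ENNReal.toReal_pos (Metric.measure_ball_pos _ _ one_pos).ne' measure_ball_lt_top.ne
  refine absurd (nonpos_of_mul_pow_le (κ := g y₀ ^ 2 / 2 *
      ((1 / 4) ^ M * (volume (Metric.ball (0 : E M) 1)).toReal)) (C := |g y₀| * C)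
    (fun r => ENNReal.toReal_nonneg) (by positivity) hdens ?_) (not_le.2 (by positivity))
  filter_upwards [Ioo_mem_nhdsGT hR, Ioo_mem_nhdsGT hR₁] with r hrR hrR₁
  have hr : 0 < r := hrR.1
  have hKU : Metric.closedBall y₀ r ⊆ U :=
    (Metric.closedBall_subset_closedBall hrR.2.le).trans hRU
  have hI := hint (scaledBump y₀ r) (contDiff_scaledBump y₀ r) _ (isCompact_closedBall y₀ r) hKU
    fun y hy => scaledBump_eq_zero hr fun h => hy (Metric.ball_subset_closedBall h)
  have hup := hC r hr hrR.2
  -- The identity turns the bound for `γ ∧ d(f c)` into one for `f (δγ ∧ c)`; the sign has norm one.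
  rw [hI, norm_mul, norm_pow, norm_neg, norm_one, one_pow, one_mul] at hup
  simp only [wedge_smul_right_apply] at hup
  have hlow := mul_pow_le_setIntegral_scaledBump hU hr hKU
    (G := fun y => g y₀ * g y) (continuousOn_const.mul hgc) hs2.le
    fun y hy => (hball₁ y (Metric.ball_subset_ball hrR₁.2.le hy)).le
  refine hlow.trans ?_
  have h1 : (∫ y in U, scaledBump y₀ r y * (g y₀ * g y)) =
      g y₀ * ∫ y in U, scaledBump y₀ r y * g y := by
    rw [← integral_const_mul]
    exact integral_congr_ae (Eventually.of_forall fun y => by ring)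
  have h2 : |∫ y in U, scaledBump y₀ r y * g y| ≤
      r⁻¹ * C * (volume (Metric.ball y₀ r \ Z)).toReal := by
    rw [hg]
    exact hup
  rw [h1]
  refine (le_abs_self _).trans ?_
  rw [abs_mul]
  refine (mul_le_mul_of_nonneg_left h2 (abs_nonneg _)).trans_eq ?_
  ring

end Euclidean

/-! ### Isolating matrix entries and localizing the defining identity. -/

section Main

variable {M : ℕ} {X : Type*} [TopologicalSpace X] [ChartedSpace (E M) X]

theorem dForm_zero {h : ℕ} : dForm (0 : DForm M X h) = 0 :=
  funext fun _ => dForm_eq_zero _ (Eventually.of_forall fun _ => rfl)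

theorem wedgeForm_zero_right {p q n : ℕ} (hn : p + q = n) (ω : DForm M X p) :
    wedgeForm hn ω (0 : DForm M X q) = 0 :=
  funext fun x => wedge_zero_right hn (ω x)

/-- The matrix of forms with the single nonzero entry `φ`, at the place `(s, s)`. -/
def MatForm.single {L p : ℕ} (s : Fin L) (φ : DForm M X p) : MatForm M X L p :=
  Matrix.of fun i j => if i = s ∧ j = s then φ else 0

theorem MatForm.single_isOfClass {L p : ℕ} {s : Fin L} {φ : DForm M X p} {k m : WithTop ℕ∞}
    (hφ : IsFormOfClass k m φ) : (MatForm.single s φ).IsOfClass k m := by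
  intro i j
  by_cases hij : i = s ∧ j = s
  · simpa [MatForm.single, hij] using hφ
  · simp only [MatForm.single, Matrix.of_apply, if_neg hij]
    intro e _
    exact contDiffOn_const (c := 0)

theorem MatForm.single_hasCompactSupp {L p : ℕ} {s : Fin L} {φ : DForm M X p}
    (hφ : IsCompact (formSupport φ)) : (MatForm.single s φ).HasCompactSupp := by
  intro i j
  by_cases hij : i = s ∧ j = s
  · simpa [MatForm.single, hij] using hφ
  · simp only [MatForm.single, Matrix.of_apply, if_neg hij]
    simp [formSupport]

/-- Only the summand with inner index `s` survives, so varying `i` and `s` tests every entry of `ω`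
separately. -/
theorem MatForm.wedge_single_apply {L p q n : ℕ} (hn : p + q = n) (ω : MatForm M X L p)
    (i s : Fin L) (φ : DForm M X q) :
    MatForm.wedge hn ω (MatForm.single s φ) i s = wedgeForm hn (ω i s) φ := by
  simp only [MatForm.wedge, Matrix.of_apply]
  refine (Finset.sum_eq_single s (fun t _ ht => ?_) (by simp)).trans ?_
  · simp [MatForm.single, ht, wedgeForm_zero_right]
  · simp [MatForm.single]

theorem MatForm.d_single {L p : ℕ} (s : Fin L) (φ : DForm M X p) :
    (MatForm.single s φ).d = MatForm.single s (dForm φ) := by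
  ext i j : 2
  by_cases hij : i = s ∧ j = s
  · simp [MatForm.d, MatForm.single, hij]
  · simp only [MatForm.d, MatForm.single, Matrix.of_apply, if_neg hij, dForm_zero]

variable [T2Space X] [ParacompactSpace X]

/-- The defining identity of the distributional exterior derivative, written in an oriented
chart. -/
theorem IsDED.setIntegral_eq {k : ℕ∞} (hk : 2 ≤ k) [IsManifold (𝓡 M) k X] {L h p : ℕ}
    {o : ManifoldOrientation M k X} {γ : MatForm M X L h} {δγ : MatForm M X L (h + 1)}
    (hδγ : IsDED o γ δγ) (hγ : γ.IsOfClass k 0) (hM : h + 1 + p = M) (hM' : h + (p + 1) = M)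
    {e : OpenPartialHomeomorph X (E M)} (he : e ∈ o.charts) (c : (E M) [⋀^Fin p]→L[ℝ] ℝ)
    {f : E M → ℝ} (hf : ∀ n : ℕ∞, ContDiff ℝ n f) {K : Set (E M)} (hK : IsCompact K)
    (hKe : K ⊆ e.target) (hfK : ∀ y ∉ K, f y = 0) (i s : Fin L) :
    (∫ y in e.target, wedge hM' (localRep e (γ i s) y) (extDeriv (fun z => f z • c) y)
      (fun i => EuclideanSpace.single i (1 : ℝ))) =
    (-1 : ℝ) ^ (h + 1) * ∫ y in e.target, wedge hM (localRep e (δγ i s) y) (f y • c)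
      (fun i => EuclideanSpace.single i (1 : ℝ)) := by
  have hk2 : (2 : WithTop ℕ∞) ≤ k := WithTop.coe_le_coe.2 hk
  have hk1 : (1 : WithTop ℕ∞) ≤ k := one_le_two.trans hk2
  have hec := o.charts_subset he
  have he1 := IsManifold.maximalAtlas_subset_of_le hk1 hec
  have hηK : ∀ y ∉ K, f y • c = 0 := fun y hy => by rw [hfK y hy, zero_smul]
  have hηC : ContDiff ℝ 1 fun z => f z • c := (hf 1).smul contDiff_const
  set φ : DForm M X p := chartForm e fun y => f y • c with hφ
  have hloc : EqOn (localRep e φ) (fun y => f y • c) e.target := fun y hy =>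
    localRep_chartForm _ he1 hy
  have hdloc : EqOn (localRep e (dForm φ)) (extDeriv fun y => f y • c) e.target := fun y hy => by
    have h1 : localRep e φ =ᶠ[𝓝 y] fun y => f y • c :=
      hloc.eventuallyEq_of_mem (e.open_target.mem_nhds hy)
    rw [localRep_dForm hk2 φ hec hy
      (((hηC.differentiable one_ne_zero) y).congr_of_eventuallyEq h1), h1.extDeriv_eq]
  have hclass : IsFormOfClass k ((k - 1 : ℕ∞) : WithTop ℕ∞) φ := by
    refine isFormOfClass_chartForm ?_ hec (hf k) c hK hKe hfK
    -- Truncated subtraction is harmless as `1 ≤ k`, and `k = ∞` is covered.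
    have : k - 1 + 1 = k := tsub_add_cancel_of_le (one_le_two.trans hk)
    exact_mod_cast this.le
  have key := hδγ.2 p hM (MatForm.single s φ) (MatForm.single_isOfClass hclass)
    (MatForm.single_hasCompactSupp (isCompact_formSupport_chartForm hK hKe hηK))
  have key' := congrFun (congrFun key i) s
  rw [MatForm.d_single] at key'
  simp only [ManifoldOrientation.matIntegral, Matrix.of_apply, Matrix.smul_apply, smul_eq_mul,
    MatForm.wedge_single_apply] at key'
  have hγc : ContinuousOn (localRep e (γ i s)) e.target := (hγ i s e hec).continuousOn
  have hδc : ContinuousOn (localRep e (δγ i s)) e.target := (hδγ.1 i s e hec).continuousOn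
  have hL : EqOn (fun y => localRep e (wedgeForm hM' (γ i s) (dForm φ)) y
      (fun i => EuclideanSpace.single i (1 : ℝ)))
      (fun y => wedge hM' (localRep e (γ i s) y) (extDeriv (fun z => f z • c) y)
        (fun i => EuclideanSpace.single i (1 : ℝ))) e.target := fun y hy => by
    simp only [localRep_wedgeForm, hdloc hy]
  have hR : EqOn (fun y => localRep e (wedgeForm hM (δγ i s) φ) y
      (fun i => EuclideanSpace.single i (1 : ℝ)))
      (fun y => wedge hM (localRep e (δγ i s) y) (f y • c)
        (fun i => EuclideanSpace.single i (1 : ℝ))) e.target := fun y hy => by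
    simp only [localRep_wedgeForm, hloc hy]
  have hIL := o.integral_eq_setIntegral hk1 he (wedgeForm hM' (γ i s) (dForm φ)) hK hKe
    (fun x hx => (congrArg (SuperdensityForms.wedge hM' (γ i s x))
      (dForm_chartForm_eq_zero hK hKe hηK hx)).trans (wedge_zero_right hM' _))
    ((continuousOn_wedge_apply hM' hγc (continuous_extDeriv hηC).continuousOn _).congr hL)
  have hIR := o.integral_eq_setIntegral hk1 he (wedgeForm hM (δγ i s) φ) hK hKe
    (fun x hx => (congrArg (SuperdensityForms.wedge hM (δγ i s x))
      (chartForm_eq_zero_of_notMem hηK hx)).trans (wedge_zero_right hM _))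
    ((continuousOn_wedge_apply hM hδc hηC.continuous.continuousOn _).congr hR)
  rw [hIL, hIR, setIntegral_congr_fun e.open_target.measurableSet hL,
    setIntegral_congr_fun e.open_target.measurableSet hR] at key'
  exact key'

end Main

end SuperdensityForms

end

open SuperdensityForms in
theorem theorem3p1 {M L h : ℕ} (hh : h + 1 ≤ M) {k : ℕ∞} (hk : 2 ≤ k)
    {X : Type*} [TopologicalSpace X] [T2Space X] [ParacompactSpace X]
    [ChartedSpace (EuclideanSpace ℝ (Fin M)) X] [IsManifold (𝓡 M) k X]
    (o : ManifoldOrientation M k X)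
    (γ : MatForm M X L h) (hγ : γ.IsOfClass k 0)
    (δγ : MatForm M X L (h + 1)) (hδγ : IsDED o γ δγ)
    (Q : X) (hQ : IsDensityPoint (M := M) ((M : ℝ) + 1) γ.zeroSet Q) :
    δγ.eval Q = 0 := by
  have hk1 : (1 : WithTop ℕ∞) ≤ k := by exact_mod_cast one_le_two.trans hk
  have : IsManifold (𝓡 M) 1 X := IsManifold.of_le hk1
  obtain ⟨e, he, hQe⟩ := o.cover Q
  obtain ⟨e', he', hQe', hdens⟩ := hQ
  have hec := o.charts_subset he
  have he1 := IsManifold.maximalAtlas_subset_of_le hk1 hec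
  -- The chart witnessing superdensity is only `C^1` and need not be oriented, hence the transfer to
  -- `e`.
  have hdens' := isLittleO_density_chart he' he1 hQe' hQe hdens
  obtain ⟨p, hp⟩ := Nat.exists_eq_add_of_le hh
  have hM' : h + (p + 1) = M := by omega
  refine Matrix.ext fun i s => ?_
  refine eq_zero_of_localRep_eq_zero (δγ i s) he1 hQe
    (eq_zero_of_wedge_eq_zero hp.symm _ fun c => ?_)
  refine wedge_eq_zero_of_density hp.symm hM' e.open_target (e.map_source hQe)
    (hγ i s e hec).continuousOn (hδγ.1 i s e hec).continuousOn c
    (fun f hf K hK hKe hfK => hδγ.setIntegral_eq hk hγ hp.symm hM' he c hf hK hKe hfK i s)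
    (fun y hy => ?_) hdens'
  obtain ⟨x, hx, rfl⟩ := hy
  have hx0 : γ i s x = 0 := congrFun (congrFun hx.1 i) s
  refine localRep_eq_zero ?_
  rw [e.left_inv hx.2]
  exact hx0
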